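/- **Setting.** Let $\varphi:\mathbb R\to[0,\infty]$ be convex and lower semicontinuous with $\varphi(1)=0$, $\varphi=+\infty$ on $(-\infty,0)$, and finite in a neighbourhood of $1$; call such a $\varphi$ a generator. Write $\operatorname{dom}\varphi=\{\varphi<\infty\}$ and $\varphi'(\infty)=\lim_{x\to\infty}\varphi(x)/x$. For probability measures $\mu,\nu$ on a measurable space $(\Omega,\mathcal F)$ with Lebesgue decomposition $\mu=\mu_c+\mu_s$, $\mu_c\ll\nu$, $\mu_s\perp\nu$, let $$D_\varphi(\mu\|\nu)=\int\varphi\Big(\frac{d\mu_c}{d\nu}\Big)d\nu+\mu_s(\Omega)\,\varphi'(\infty)\quad(0\cdot\infty=0),\qquad TV(\mu,\nu)=\sup\Big\{\Big|\int g\,d\mu-\int g\,d\nu\Big| : g:\Omega\to[-1,1]\text{ measurable}\Big\}.$$ Let $\psi(x)=\varphi(x+1)$, $\psi^*(y)=\sup_x\{xy-\psi(x)\}$, and for $w\ge 0$ let $h_{\psi^*}(w)=\inf\{h\in[0,\infty] : \mathrm{Leb}\{x:\psi^*(x)\le h\}\ge w\}$ be the height-for-width function of $\psi^*$. Derivatives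 of $\varphi$ are taken at interior points of $\operatorname{dom}\varphi$. **Theorem.** (1) Let $\varphi$ be a generator that is strictly convex on $\operatorname{dom}\varphi$, twice differentiable on the interior of $\operatorname{dom}\varphi$ and thrice differentiable at $1$, with $\varphi''(1)>0$ and $$\frac{27\,\varphi''(1)}{\big(3-z\,\varphi'''(1)/\varphi''(1)\big)^3}\le\varphi''(1+z)$$ for all $z\ge-1$ with $1+z$ in the interior of $\operatorname{dom}\varphi$. Then $$h_{\psi^*}(t)\le\frac{t^2}{8\varphi''(1)}\ \text{ for all } t\ge 0,\qquad D_\varphi(\mu\|\nu)\ge\frac{\varphi''(1)}2\,TV(\mu,\nu)^2\ \text{ for all probability measures }\mu,\nu\text{ on }\Omega.\tag{$*$}$$ (2) Let $\varphi$ be a generator that is strictly convex on $\operatorname{dom}\varphi$ and, on the interior of $\operatorname{dom}\varphi$, twice differentiable with $\varphi''>0$ and $1/\varphi''$ concave; suppose also that $\psi^*(x)\to\infty$ as $x\uparrow\varphi'(\infty)$. Then $(*)$ holds. The last condition holds for every generator with $\varphi'(\infty)=\infty$. (3) The constant in $(*)$ is optimal: if a generator $\varphi$ is twice differentiable at $1$,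 $\mathcal F\ne\{\emptyset,\Omega\}$, and $K\in\mathbb R$ satisfies $D_\varphi(\mu\|\nu)\ge K\,TV(\mu,\nu)^2$ for all probability measures $\mu,\nu$ on $\Omega$, then $K\le\varphi''(1)/2$. (4) For $\alpha\in[-1,2]$ let $\varphi_\alpha(x)=\frac{x^\alpha-\alpha(x-1)-1}{\alpha(\alpha-1)}$ for $x>0$, with $\varphi_1(x)=x\log x-x+1$ and $\varphi_0(x)=x-1-\log x$, extended to $x=0$ by its limit and by $+\infty$ to $x<0$. Then $\varphi_\alpha$ is a generator satisfying the hypotheses of (1), and also those of (2) when $\alpha\in[1,2]$. Consequently $h_{\psi_\alpha^*}(t)\le t^2/8$ for all $t\ge 0$, where $\psi_\alpha(x)=\varphi_\alpha(x+1)$, and $D_{\varphi_\alpha}(\mu\|\nu)\ge\frac12TV(\mu,\nu)^2$ for all probability measures $\mu,\nu$ on $\Omega$. (5) (Pinsker) $KL(\mu\|\nu)\ge\frac12TV(\mu,\nu)^2$ for all probability measures $\mu,\nu$ on $\Omega$. (6) (Hoeffding) If $\nu$ is a probability measure on $\Omega$ and $g$ is measurable with $m\le g\le M$ $\nu$-almost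 surely, then $\log\int e^{t(g-\int g\,d\nu)}\,d\nu\le (M-m)^2t^2/8$ for all $t\in\mathbb R$. -/

import Mathlib

open MeasureTheory Set Filter Topology
open scoped ENNReal NNReal

noncomputable section

/-- The effective domain of `φ : ℝ → [0, ∞]`. -/
def effDom (φ : ℝ → ℝ≥0∞) : Set ℝ := {x | φ x ≠ ⊤}

/-- Generators of `φ`-divergences between probability measures, in the usual normalisation:
`φ` is convex, lower semicontinuous, non-negative with `φ 1 = 0` (so `1` is a global minimiser),
infinite on the negative reals, and finite in a neighbourhood of `1`. -/
structure IsGenerator (φ : ℝ → ℝ≥0∞) : Prop where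
  convex : ∀ (x y : ℝ) (a b : ℝ≥0), a + b = 1 →
    φ ((a : ℝ) * x + (b : ℝ) * y) ≤ (a : ℝ≥0∞) * φ x + (b : ℝ≥0∞) * φ y
  lsc : LowerSemicontinuous φ
  map_one : φ 1 = 0
  eq_top_of_neg : ∀ x < 0, φ x = ⊤
  one_mem : (1 : ℝ) ∈ interior (effDom φ)

/-- `φ'(∞) = lim_{x → ∞} φ(x) / x` in `[0, ∞]`
(for convex `φ` the limit exists, so it is the `limsup`). -/
def slopeAtTop (φ : ℝ → ℝ≥0∞) : ℝ≥0∞ :=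
  limsup (fun x : ℝ => φ x / ENNReal.ofReal x) atTop

/-- The `φ`-divergence `D_φ(μ‖ν) = ∫ φ(dμ_c/dν) dν + μ_s(Ω) φ'(∞)`, where `μ = μ_c + μ_s` is the
Lebesgue decomposition of `μ` with respect to `ν`, and `0 · ∞ = 0`. -/
def phiDiv {Ω : Type*} [MeasurableSpace Ω] (φ : ℝ → ℝ≥0∞) (μ ν : Measure Ω) : ℝ≥0∞ :=
  ∫⁻ ω, φ ((μ.rnDeriv ν ω).toReal) ∂ν + μ.singularPart ν univ * slopeAtTop φ

/-- The total variation distance, i.e. the integral probability metric of the class of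
measurable functions with values in `[-1, 1]`. -/
def tvDist {Ω : Type*} [MeasurableSpace Ω] (μ ν : Measure Ω) : ℝ :=
  ⨆ g : {g : Ω → ℝ // Measurable g ∧ ∀ ω, g ω ∈ Icc (-1 : ℝ) 1},
    |∫ ω, g.1 ω ∂μ - ∫ ω, g.1 ω ∂ν|

/-- The convex conjugate of a function on the real line. -/
def conjugate (f : ℝ → EReal) (y : ℝ) : EReal :=
  ⨆ x : ℝ, ((x * y : ℝ) : EReal) - f x

/-- `ψ*`, the convex conjugate of `ψ(x) = φ(x + 1)`. -/
def psiStar (φ : ℝ → ℝ≥0∞) : ℝ → EReal :=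
  conjugate fun x => ((φ (x + 1) : ℝ≥0∞) : EReal)

/-- The sublevel set volume function of `f`. -/
def sublevelVolume (f : ℝ → EReal) (h : ℝ≥0∞) : ℝ≥0∞ :=
  volume {x : ℝ | f x ≤ (h : EReal)}

/-- The height-for-width function of (a non-negative function) `f`: the right inverse of its
sublevel set volume function. -/
def heightForWidth (f : ℝ → EReal) (w : ℝ) : ℝ≥0∞ :=
  sInf {h : ℝ≥0∞ | ENNReal.ofReal w ≤ sublevelVolume f h}

/-- `φ''`, used at interior points of the effective domain only. -/
def secondDeriv (φ : ℝ → ℝ≥0∞) : ℝ → ℝ :=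
  deriv (deriv fun x => (φ x).toReal)

/-- `φ'''`. -/
def thirdDeriv (φ : ℝ → ℝ≥0∞) : ℝ → ℝ :=
  deriv (secondDeriv φ)

/-- `φ` is twice differentiable at every interior point of its effective domain. -/
def TwiceDifferentiable (φ : ℝ → ℝ≥0∞) : Prop :=
  ∀ x ∈ interior (effDom φ), DifferentiableAt ℝ (fun y => (φ y).toReal) x ∧
    DifferentiableAt ℝ (deriv fun y => (φ y).toReal) x

/-- The third-order comparison condition. The inequality is required at interior points of the
domain; outside the domain `φ''` counts as `+∞`. -/
structure ThirdOrderCondition (φ : ℝ → ℝ≥0∞) : Prop where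
  strictConvex : StrictConvexOn ℝ (effDom φ) fun x => (φ x).toReal
  twiceDiff : TwiceDifferentiable φ
  thriceDiffAtOne : DifferentiableAt ℝ (secondDeriv φ) 1
  secondDeriv_one_pos : 0 < secondDeriv φ 1
  comparison : ∀ z : ℝ, -1 ≤ z → 1 + z ∈ interior (effDom φ) →
    27 * secondDeriv φ 1 / (3 - z * thirdDeriv φ 1 / secondDeriv φ 1) ^ 3 ≤ secondDeriv φ (1 + z)

/-- `lim ψ*(x) = ∞` as the real number `x` tends to `φ'(∞) ∈ (0, ∞]` from the left. -/
def PsiStarBlowsUp (φ : ℝ → ℝ≥0∞) : Prop :=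
  Tendsto (psiStar φ) (comap ((↑) : ℝ → EReal) (𝓝[<] ((slopeAtTop φ : ℝ≥0∞) : EReal))) (𝓝 ⊤)

/-- The condition that `1 / φ''` is concave and `ψ*` blows up at `φ'(∞)`. -/
structure ConcaveCondition (φ : ℝ → ℝ≥0∞) : Prop where
  strictConvex : StrictConvexOn ℝ (effDom φ) fun x => (φ x).toReal
  twiceDiff : TwiceDifferentiable φ
  secondDeriv_pos : ∀ x ∈ interior (effDom φ), 0 < secondDeriv φ x
  concave : ConcaveOn ℝ (interior (effDom φ)) fun x => 1 / secondDeriv φ x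
  blowsUp : PsiStarBlowsUp φ

/-- The generator of the `α`-divergence, extended to `α = 0` (reverse Kullback-Leibler) and
`α = 1` (Kullback-Leibler) by continuity in `α`, to `x = 0` by continuity in `x`, and by `+∞`
to `x < 0`. -/
def alphaGen (α : ℝ) (x : ℝ) : ℝ≥0∞ :=
  if x < 0 ∨ (x = 0 ∧ α ≤ 0) then ⊤
  else if α = 0 then ENNReal.ofReal (x - 1 - Real.log x)
  else if α = 1 then ENNReal.ofReal (x * Real.log x - x + 1)
  else ENNReal.ofReal ((x ^ α - α * (x - 1) - 1) / (α * (α - 1)))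

end

/-! Both inequalities follow from one pointwise bound, `RationalLowerBound`: with `u = x - 1` and `w
= 1 + b u > 0`, `φ(x) ≥ κ u² / w`, where `κ = φ''(1) / 2`.

Why it suffices. The weight `w` is affine in the density, so its total mass, with the singular part
contributing `b` per unit of mass, is exactly 1. Cauchy-Schwarz then gives `D_φ ≥ κ (∫ |u|)²`, and
`∫ |u|` plus the singular mass dominates TV. It is used in the linearised form `u² / w ≥ 2 r |u| -
r² w`, which can be integrated without dividing by `w`. For the height function, `ψ* ≤ a` follows
from nonnegativity of a quadratic in `z`, and the discriminant condition cuts out an interval of `y`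
of length `4 √(κ a)`.

Why it holds. `(u² / w)'' = 2 / w³`, so two integrations from the minimum at 1 reduce it to `φ'' ≥
φ''(1) / w³` (`IsGenerator.rationalLowerBound`). The third-order comparison is this inequality with
`b = -φ'''(1) / (3 φ''(1))`. If `1 / φ''` is concave, it lies below a supporting line at 1, which
lies below `w³ / φ''(1)` by Bernoulli.

Optimality is tested on two-point measures with densities `1 ± ε`. Hoeffding's lemma is independent
of these bounds and comes from the sub-Gaussian estimate for bounded variables. -/

/-! ### Rational minorants -/

/-- `φ(x) ≥ κ (x - 1)² / (1 + b (x - 1))` on the effective domain, where the denominator is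
positive. -/
def RationalLowerBound (φ : ℝ → ℝ≥0∞) (κ b : ℝ) : Prop :=
  ∀ x ∈ effDom φ, 0 < 1 + b * (x - 1) ∧
    κ * (x - 1) ^ 2 ≤ (1 + b * (x - 1)) * (φ x).toReal

/-- Affine-in-`|x - 1|` and `x` minorants of a function with a rational lower bound. -/
lemma RationalLowerBound.ofReal_le {φ : ℝ → ℝ≥0∞} {κ b : ℝ} (hκ : 0 ≤ κ)
    (h : RationalLowerBound φ κ b) (r x : ℝ) :
    ENNReal.ofReal (κ * (2 * r * |x - 1| - r ^ 2 * (1 + b * (x - 1)))) ≤ φ x := by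
  by_cases hx : φ x = ⊤
  · simp [hx]
  obtain ⟨hw, hb⟩ := h x hx
  refine ENNReal.ofReal_le_of_le_toReal (le_of_mul_le_mul_left (le_trans ?_ hb) hw)
  -- After multiplication by the weight `w`, the claim is `κ (|u| - r w)² ≥ 0`.
  have := mul_nonneg hκ (sq_nonneg (|x - 1| - r * (1 + b * (x - 1))))
  nlinarith [sq_abs (x - 1)]

lemma RationalLowerBound.ofReal_le_slopeAtTop {φ : ℝ → ℝ≥0∞} {κ b : ℝ} (hκ : 0 ≤ κ)
    (h : RationalLowerBound φ κ b) (r : ℝ) :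
    ENNReal.ofReal (κ * (2 * r - r ^ 2 * b)) ≤ slopeAtTop φ := by
  -- The affine minorant divided by `x`, for `x ≥ 1`.
  have hlim : Tendsto (fun x : ℝ => κ * (2 * r * (1 - x⁻¹) - r ^ 2 * (x⁻¹ + b * (1 - x⁻¹))))
      atTop (𝓝 (κ * (2 * r * (1 - 0) - r ^ 2 * (0 + b * (1 - 0))))) := by
    have := tendsto_inv_atTop_zero (𝕜 := ℝ)
    exact (((this.const_sub 1).const_mul (2 * r)).sub
      ((this.add ((this.const_sub 1).const_mul b)).const_mul (r ^ 2))).const_mul κ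
  have hlim' := (ENNReal.continuous_ofReal.tendsto _).comp hlim
  have e : κ * (2 * r * (1 - 0) - r ^ 2 * (0 + b * (1 - 0))) = κ * (2 * r - r ^ 2 * b) := by ring
  rw [e] at hlim'
  rw [← hlim'.limsup_eq, slopeAtTop]
  refine limsup_le_limsup ?_
  filter_upwards [eventually_ge_atTop (1 : ℝ)] with x hx
  have hx0 : 0 < x := by linarith
  rw [ENNReal.le_div_iff_mul_le (by simp [hx0]) (by simp), Function.comp_apply,
    ← ENNReal.ofReal_mul' hx0.le]
  refine le_trans (le_of_eq ?_) (h.ofReal_le hκ r x)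
  rw [abs_of_nonneg (by linarith)]
  congr 1
  field_simp

/-! ### Densities, singular parts and total variation -/

/-- Discarding the negative part only increases the integral. The affine minorants change sign,
while `φ` takes values in `[0, ∞]`. -/
lemma ofReal_integral_le_lintegral_ofReal {Ω : Type*} [MeasurableSpace Ω] {ν : Measure Ω}
    {f : Ω → ℝ} (hf : Integrable f ν) :
    ENNReal.ofReal (∫ ω, f ω ∂ν) ≤ ∫⁻ ω, ENNReal.ofReal (f ω) ∂ν := by
  rw [integral_eq_lintegral_pos_part_sub_lintegral_neg_part hf]
  exact (ENNReal.ofReal_le_ofReal (sub_le_self _ ENNReal.toReal_nonneg)).trans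
    ENNReal.ofReal_toReal_le

lemma integral_eq_integral_rnDeriv_mul_add {Ω : Type*} [MeasurableSpace Ω] (μ ν : Measure Ω)
    [IsFiniteMeasure μ] [IsFiniteMeasure ν] {g : Ω → ℝ} (hg : Integrable g μ) :
    ∫ ω, g ω ∂μ = ∫ ω, (μ.rnDeriv ν ω).toReal * g ω ∂ν + ∫ ω, g ω ∂(μ.singularPart ν) := by
  have hdec := μ.haveLebesgueDecomposition_add ν
  have hle1 : μ.singularPart ν ≤ μ := Measure.singularPart_le _ _
  have hle2 : ν.withDensity (μ.rnDeriv ν) ≤ μ := Measure.withDensity_rnDeriv_le _ _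
  conv_lhs => rw [hdec]
  rw [integral_add_measure (hg.mono_measure hle1) (hg.mono_measure hle2), add_comm,
    integral_withDensity_eq_integral_toReal_smul (Measure.measurable_rnDeriv _ _)
      (Measure.rnDeriv_lt_top _ _)]
  simp

lemma integral_toReal_rnDeriv_add_singularPart {Ω : Type*} [MeasurableSpace Ω] (μ ν : Measure Ω)
    [IsProbabilityMeasure μ] [IsFiniteMeasure ν] :
    ∫ ω, (μ.rnDeriv ν ω).toReal ∂ν + (μ.singularPart ν).real univ = 1 := by
  have := integral_eq_integral_rnDeriv_mul_add μ ν (g := fun _ => 1) (integrable_const _)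
  simpa using this.symm

lemma tvDist_nonneg {Ω : Type*} [MeasurableSpace Ω] (μ ν : Measure Ω) : 0 ≤ tvDist μ ν :=
  Real.iSup_nonneg fun _ => abs_nonneg _

lemma abs_integral_sub_integral_le {Ω : Type*} [MeasurableSpace Ω] (μ ν : Measure Ω)
    [IsProbabilityMeasure μ] [IsProbabilityMeasure ν] {g : Ω → ℝ} (hg : Measurable g)
    (hg1 : ∀ ω, g ω ∈ Icc (-1 : ℝ) 1) :
    |∫ ω, g ω ∂μ - ∫ ω, g ω ∂ν| ≤
      ∫ ω, |(μ.rnDeriv ν ω).toReal - 1| ∂ν + (μ.singularPart ν).real univ := by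
  have hint : ∀ (ρ : Measure Ω) [IsFiniteMeasure ρ], Integrable g ρ := fun ρ _ =>
    Integrable.of_mem_Icc (-1) 1 hg.aemeasurable (ae_of_all _ hg1)
  have habs : ∀ ω, |g ω| ≤ 1 := fun ω => abs_le.2 (hg1 ω)
  have hfi : Integrable (fun ω => (μ.rnDeriv ν ω).toReal) ν := Measure.integrable_toReal_rnDeriv
  have hfg : Integrable (fun ω => (μ.rnDeriv ν ω).toReal * g ω) ν :=
    hfi.mul_bdd (c := 1) hg.aestronglyMeasurable (ae_of_all _ habs)
  have h1 : |∫ ω, ((μ.rnDeriv ν ω).toReal * g ω - g ω) ∂ν| ≤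
      ∫ ω, |(μ.rnDeriv ν ω).toReal - 1| ∂ν := by
    refine abs_integral_le_integral_abs.trans
      (integral_mono_of_nonneg (ae_of_all _ fun _ => abs_nonneg _)
        (hfi.sub (integrable_const _)).abs (ae_of_all _ fun ω => ?_))
    show |_| ≤ |_|
    rw [← sub_one_mul, abs_mul]
    exact mul_le_of_le_one_right (abs_nonneg _) (habs ω)
  have h2 : |∫ ω, g ω ∂(μ.singularPart ν)| ≤ (μ.singularPart ν).real univ := by
    simpa using norm_integral_le_of_norm_le_const (f := g) (μ := μ.singularPart ν) (ae_of_all _ habs)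
  rw [integral_sub hfg (hint ν)] at h1
  rw [integral_eq_integral_rnDeriv_mul_add μ ν (hint μ)]
  rw [abs_le] at *
  constructor <;> linarith [h1.1, h1.2, h2.1, h2.2]

/-- A real supremum dominates its members only if the family is bounded above;
`abs_integral_sub_integral_le` supplies the bound. -/
lemma le_tvDist {Ω : Type*} [MeasurableSpace Ω] (μ ν : Measure Ω)
    [IsProbabilityMeasure μ] [IsProbabilityMeasure ν] {g : Ω → ℝ} (hg : Measurable g)
    (hg1 : ∀ ω, g ω ∈ Icc (-1 : ℝ) 1) :
    |∫ ω, g ω ∂μ - ∫ ω, g ω ∂ν| ≤ tvDist μ ν :=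
  le_ciSup (f := fun g : {g : Ω → ℝ // Measurable g ∧ ∀ ω, g ω ∈ Icc (-1 : ℝ) 1} =>
      |∫ ω, g.1 ω ∂μ - ∫ ω, g.1 ω ∂ν|)
    ⟨_, forall_mem_range.2 fun g => abs_integral_sub_integral_le μ ν g.2.1 g.2.2⟩ ⟨g, hg, hg1⟩

lemma tvDist_le {Ω : Type*} [MeasurableSpace Ω] (μ ν : Measure Ω)
    [IsProbabilityMeasure μ] [IsProbabilityMeasure ν] :
    tvDist μ ν ≤ ∫ ω, |(μ.rnDeriv ν ω).toReal - 1| ∂ν + (μ.singularPart ν).real univ :=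
  Real.iSup_le (fun g => abs_integral_sub_integral_le μ ν g.2.1 g.2.2)
    (add_nonneg (integral_nonneg fun _ => abs_nonneg _) measureReal_nonneg)

/-! ### Divergence and height bounds from a rational minorant -/

theorem RationalLowerBound.ofReal_mul_tvDist_sq_le_phiDiv {φ : ℝ → ℝ≥0∞} {κ b : ℝ} (hκ : 0 ≤ κ)
    (h : RationalLowerBound φ κ b) {Ω : Type*} [MeasurableSpace Ω] (μ ν : Measure Ω)
    [IsProbabilityMeasure μ] [IsProbabilityMeasure ν] :
    ENNReal.ofReal (κ * tvDist μ ν ^ 2) ≤ phiDiv φ μ ν := by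
  set s : ℝ := (μ.singularPart ν).real univ with hs
  set I : ℝ := ∫ ω, |(μ.rnDeriv ν ω).toReal - 1| ∂ν with hI
  -- This `r` maximises `2 r (I + s) - r²`, the sum of the two contributions below up to the factor
  -- `κ`.
  set r : ℝ := I + s with hr
  have hfi : Integrable (fun ω => (μ.rnDeriv ν ω).toReal) ν := Measure.integrable_toReal_rnDeriv
  have hfi1 : Integrable (fun ω => (μ.rnDeriv ν ω).toReal - 1) ν := hfi.sub (integrable_const _)
  have hw : Integrable (fun ω => r ^ 2 * (1 + b * ((μ.rnDeriv ν ω).toReal - 1))) ν :=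
    ((integrable_const _).add (hfi1.const_mul _)).const_mul _
  have hH : Integrable (fun ω => κ * (2 * r * |(μ.rnDeriv ν ω).toReal - 1| -
      r ^ 2 * (1 + b * ((μ.rnDeriv ν ω).toReal - 1)))) ν :=
    ((hfi1.abs.const_mul _).sub hw).const_mul _
  -- The density has mass `1 - s`, so the weight integrates to `1 - b s`; the missing `b s` is
  -- restored by the slope at infinity in `h2`.
  have hint : ∫ ω, κ * (2 * r * |(μ.rnDeriv ν ω).toReal - 1| -
      r ^ 2 * (1 + b * ((μ.rnDeriv ν ω).toReal - 1))) ∂ν =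
      κ * (2 * r * I - r ^ 2 * (1 - b * s)) := by
    rw [integral_const_mul, integral_sub (hfi1.abs.const_mul _) hw, integral_const_mul,
      integral_const_mul, integral_add (integrable_const _) (hfi1.const_mul _),
      integral_const_mul, integral_sub hfi (integrable_const _),
      eq_sub_of_add_eq (integral_toReal_rnDeriv_add_singularPart μ ν), ← hI, ← hs]
    simp only [integral_const, probReal_univ, smul_eq_mul, one_mul]
    ring
  have h1 : ENNReal.ofReal (κ * (2 * r * I - r ^ 2 * (1 - b * s))) ≤
      ∫⁻ ω, φ ((μ.rnDeriv ν ω).toReal) ∂ν := by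
    rw [← hint]
    exact (ofReal_integral_le_lintegral_ofReal hH).trans
      (lintegral_mono fun ω => h.ofReal_le hκ r _)
  have h2 : ENNReal.ofReal (s * (κ * (2 * r - r ^ 2 * b))) ≤
      μ.singularPart ν univ * slopeAtTop φ := by
    rw [ENNReal.ofReal_mul measureReal_nonneg, ofReal_measureReal]
    gcongr
    exact h.ofReal_le_slopeAtTop hκ r
  have htv : tvDist μ ν ^ 2 ≤ r ^ 2 := pow_le_pow_left₀ (tvDist_nonneg _ _) (tvDist_le μ ν) 2
  calc ENNReal.ofReal (κ * tvDist μ ν ^ 2)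
      ≤ ENNReal.ofReal (κ * (2 * r * I - r ^ 2 * (1 - b * s)) +
          s * (κ * (2 * r - r ^ 2 * b))) := by
        refine ENNReal.ofReal_le_ofReal ((mul_le_mul_of_nonneg_left htv hκ).trans (le_of_eq ?_))
        rw [hr]; ring
    _ ≤ _ := ENNReal.ofReal_add_le
    _ ≤ phiDiv φ μ ν := add_le_add h1 h2

theorem RationalLowerBound.heightForWidth_le {φ : ℝ → ℝ≥0∞} {κ b : ℝ} (hκ : 0 < κ)
    (h : RationalLowerBound φ κ b) {t : ℝ} (ht : 0 ≤ t) :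
    heightForWidth (psiStar φ) t ≤ ENNReal.ofReal (t ^ 2 / (16 * κ)) := by
  refine sInf_le ?_
  rw [mem_ofPred_eq]
  rcases ht.eq_or_lt with rfl | ht
  · simp
  set a : ℝ := t ^ 2 / (16 * κ) with ha
  have ha0 : 0 < a := by positivity
  have hat : t ^ 2 = 16 * κ * a := by rw [ha]; field_simp
  -- The interval is `|y + a b| ≤ t / 2`. Since `t² = 16 κ a`, this is the discriminant condition
  -- `hdisc` for the quadratic `a - z (y - a b) + z² (κ - b y)`, whose nonnegativity is the claim
  -- multiplied by the weight.
  have hsub : Icc (-(t / 2) - a * b) (t / 2 - a * b) ⊆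
      {y | psiStar φ y ≤ ((ENNReal.ofReal a : ℝ≥0∞) : EReal)} := by
    rintro y ⟨hy1, hy2⟩
    rw [mem_ofPred_eq, psiStar, conjugate]
    refine iSup_le fun z => ?_
    by_cases hz : φ (z + 1) = ⊤
    · simp [hz]
    obtain ⟨hw, hP⟩ := h (z + 1) hz
    rw [add_sub_cancel_right] at hw hP
    rw [← ENNReal.ofReal_toReal hz, EReal.coe_ennreal_ofReal, EReal.coe_ennreal_ofReal,
      max_eq_left ENNReal.toReal_nonneg, max_eq_left ha0.le, ← EReal.coe_sub, EReal.coe_le_coe_iff]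
    refine le_of_mul_le_mul_left ?_ hw
    have hdisc : (y - a * b) ^ 2 ≤ 4 * a * (κ - b * y) := by
      nlinarith [mul_nonneg (sub_nonneg.2 hy1) (sub_nonneg.2 hy2)]
    -- Completing the square after multiplication by `4 a` needs no sign for the leading coefficient
    -- `κ - b y`.
    have hsq : 0 ≤ (z * (y - a * b) - 2 * a) ^ 2 + z ^ 2 * (4 * a * (κ - b * y) - (y - a * b) ^ 2) :=
      add_nonneg (sq_nonneg _) (mul_nonneg (sq_nonneg _) (by linarith))
    have : 0 ≤ 4 * a * (a - z * (y - a * b) + z ^ 2 * (κ - b * y)) := by nlinarith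
    have := nonneg_of_mul_nonneg_right this (by linarith)
    nlinarith
  refine le_trans ?_ (measure_mono hsub)
  rw [Real.volume_Icc]
  exact ENNReal.ofReal_le_ofReal (le_of_eq (by ring))

theorem RationalLowerBound.height_and_divergence_bounds {φ : ℝ → ℝ≥0∞} {A b : ℝ} (hA : 0 < A)
    (h : RationalLowerBound φ (A / 2) b) {Ω : Type*} [MeasurableSpace Ω] :
    (∀ t : ℝ, 0 ≤ t → heightForWidth (psiStar φ) t ≤ ENNReal.ofReal (t ^ 2 / (8 * A))) ∧
      ∀ μ ν : Measure Ω, IsProbabilityMeasure μ → IsProbabilityMeasure ν →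
        ENNReal.ofReal (A / 2 * tvDist μ ν ^ 2) ≤ phiDiv φ μ ν := by
  refine ⟨fun t ht => ?_, fun μ ν _ _ =>
    h.ofReal_mul_tvDist_sq_le_phiDiv (by positivity) μ ν⟩
  rw [show 8 * A = 16 * (A / 2) by ring]
  exact h.heightForWidth_le (by positivity) ht

/-! ### Convexity and twofold integration -/

/-- The right derivative is a subgradient: it separates the slopes of chords to the left from those
to the right. -/
lemma ConvexOn.exists_affine_le_of_mem_interior {S : Set ℝ} {f : ℝ → ℝ} (hf : ConvexOn ℝ S f)
    {a : ℝ} (ha : a ∈ interior S) : ∃ k : ℝ, ∀ y ∈ S, f a + k * (y - a) ≤ f y := by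
  refine ⟨derivWithin f (Ioi a) a, fun y hy => ?_⟩
  rcases lt_trichotomy a y with h | rfl | h
  · have := hf.rightDeriv_le_slope_of_mem_interior ha hy h
    rw [slope_def_field, le_div_iff₀ (by linarith)] at this
    linarith
  · simp
  · have := (hf.slope_le_leftDeriv_of_mem_interior hy ha h).trans
      (hf.leftDeriv_le_rightDeriv_of_mem_interior ha)
    rw [slope_def_field, div_le_iff₀ (by linarith)] at this
    linarith

lemma le_of_deriv_eq_zero_of_deriv2_nonneg {S : Set ℝ} (hS : Convex ℝ S) (hSo : IsOpen S)
    {f f' f'' : ℝ → ℝ} (hf : ∀ x ∈ S, HasDerivAt f (f' x) x)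
    (hf' : ∀ x ∈ S, HasDerivAt f' (f'' x) x) (hf'' : ∀ x ∈ S, 0 ≤ f'' x)
    {a : ℝ} (ha : a ∈ S) (ha' : f' a = 0) {x : ℝ} (hx : x ∈ S) : f a ≤ f x := by
  have hc : ConvexOn ℝ S f := convexOn_of_hasDerivWithinAt2_nonneg (f' := f') (f'' := f'') hS
    (fun x hx => (hf x hx).continuousAt.continuousWithinAt)
    (fun x hx => (hf x (interior_subset hx)).hasDerivWithinAt)
    (fun x hx => (hf' x (interior_subset hx)).hasDerivWithinAt)
    (fun x hx => hf'' x (interior_subset hx))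
  refine hc.isMinOn_of_rightDeriv_eq_zero (by rwa [hSo.interior_eq]) ?_ hx
  rw [(hf a ha).hasDerivWithinAt.derivWithin (uniqueDiffWithinAt_Ioi a), ha']

namespace IsGenerator

variable {φ : ℝ → ℝ≥0∞}

lemma convexOn (hφ : IsGenerator φ) : ConvexOn ℝ (effDom φ) fun x => (φ x).toReal := by
  have key : ∀ x ∈ effDom φ, ∀ y ∈ effDom φ, ∀ a b : ℝ, 0 ≤ a → 0 ≤ b → a + b = 1 →
      φ (a * x + b * y) ≤ ENNReal.ofReal (a * (φ x).toReal + b * (φ y).toReal) := by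
    intro x hx y hy a b ha hb hab
    have := hφ.convex x y a.toNNReal b.toNNReal
      (by rw [← Real.toNNReal_add ha hb, hab, Real.toNNReal_one])
    rw [Real.coe_toNNReal a ha, Real.coe_toNNReal b hb] at this
    refine this.trans (le_of_eq ?_)
    rw [ENNReal.ofReal_add (by positivity) (by positivity), ENNReal.ofReal_mul ha,
      ENNReal.ofReal_mul hb, ENNReal.ofReal_toReal hx, ENNReal.ofReal_toReal hy]
    rfl
  refine ⟨fun x hx y hy a b ha hb hab => ?_, fun x hx y hy a b ha hb hab => ?_⟩
  · exact ne_top_of_le_ne_top ENNReal.ofReal_ne_top (key x hx y hy a b ha hb hab)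
  · exact ENNReal.toReal_le_of_le_ofReal (by positivity) (key x hx y hy a b ha hb hab)

lemma toReal_one (hφ : IsGenerator φ) : (φ 1).toReal = 0 := by simp [hφ.map_one]

lemma nonneg_of_mem_effDom (hφ : IsGenerator φ) {x : ℝ} (hx : x ∈ effDom φ) : 0 ≤ x := by
  by_contra h
  exact hx (hφ.eq_top_of_neg x (not_le.1 h))

lemma deriv_one (hφ : IsGenerator φ) : deriv (fun x => (φ x).toReal) 1 = 0 := by
  -- `toReal` is nonnegative everywhere, with `⊤` sent to 0, so 1 is a global minimiser and the
  -- domain plays no role.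
  refine IsLocalMin.deriv_eq_zero (Eventually.of_forall fun x => ?_)
  simp [hφ.map_one]

lemma segment_mem_interior (hφ : IsGenerator φ) {x : ℝ} (hx : x ∈ effDom φ) {s : ℝ}
    (hs0 : 0 ≤ s) (hs1 : s < 1) : 1 + s * (x - 1) ∈ interior (effDom φ) := by
  have := hφ.convexOn.1.add_smul_sub_mem_interior hx hφ.one_mem (t := 1 - s)
    ⟨by linarith, by linarith⟩
  convert this using 1
  rw [smul_eq_mul]; ring

lemma toReal_segment_le (hφ : IsGenerator φ) {x : ℝ} (hx : x ∈ effDom φ) {s : ℝ}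
    (hs0 : 0 ≤ s) (hs1 : s ≤ 1) : (φ (1 + s * (x - 1))).toReal ≤ s * (φ x).toReal := by
  have := hφ.convexOn.2 (interior_subset hφ.one_mem) hx (sub_nonneg.2 hs1) hs0
    (by ring)
  simp only [smul_eq_mul, hφ.toReal_one] at this
  rw [show (1 - s) * 1 + s * x = 1 + s * (x - 1) by ring] at this
  linarith

/-- Twofold integration of `φ'' ≥ A / (1 + b (x - 1))³`. -/
lemma le_toReal_of_le_secondDeriv (hφ : IsGenerator φ) (h2 : TwiceDifferentiable φ) {A b : ℝ}
    (hA : ∀ x ∈ interior (effDom φ), 0 < 1 + b * (x - 1) →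
      A / (1 + b * (x - 1)) ^ 3 ≤ secondDeriv φ x)
    {x : ℝ} (hx : x ∈ interior (effDom φ)) (hw : 0 < 1 + b * (x - 1)) :
    A / 2 * (x - 1) ^ 2 / (1 + b * (x - 1)) ≤ (φ x).toReal := by
  set S : Set ℝ := interior (effDom φ) ∩ {x | 0 < 1 + b * (x - 1)} with hS
  have hSo : IsOpen S := isOpen_interior.inter
    (isOpen_lt continuous_const (by fun_prop))
  have hSc : Convex ℝ S := by
    refine hφ.convexOn.1.interior.inter fun u hu v hv s t hs ht hst => ?_
    simp only [mem_ofPred_eq, smul_eq_mul] at hu hv ⊢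
    have e : 1 + b * (s * u + t * v - 1) = s * (1 + b * (u - 1)) + t * (1 + b * (v - 1)) := by
      linear_combination (b - 1) * hst
    rw [e]
    rcases hs.eq_or_lt with rfl | hs
    · have : t = 1 := by linarith
      subst this; simpa using hv
    · exact add_pos_of_pos_of_nonneg (mul_pos hs hu) (mul_nonneg ht hv.le)
  have hlin : ∀ u : ℝ, HasDerivAt (fun u => 1 + b * (u - 1)) b u := fun u => by
    simpa using (((hasDerivAt_id u).sub_const 1).const_mul b).const_add 1
  -- With `v = u - 1` and `w = 1 + b v`, `(v² / w)' = v (2 + b v) / w²` and `(v² / w)'' = 2 / w³`.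
  -- Hence the difference is convex on `S` and has value and derivative 0 at 1.
  have hf : ∀ u ∈ S, HasDerivAt
      (fun u => (φ u).toReal - A / 2 * (u - 1) ^ 2 / (1 + b * (u - 1)))
      (deriv (fun u => (φ u).toReal) u -
        A / 2 * ((u - 1) * (2 + b * (u - 1))) / (1 + b * (u - 1)) ^ 2) u := by
    intro u hu
    have hu0 : 1 + b * (u - 1) ≠ 0 := ne_of_gt hu.2
    refine ((h2 u hu.1).1.hasDerivAt.sub
      ((((hasDerivAt_id' u).sub_const 1).fun_pow 2 |>.const_mul (A / 2)).div (hlin u) hu0)).congr_deriv ?_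
    field_simp
    ring
  have hf' : ∀ u ∈ S, HasDerivAt
      (fun u => deriv (fun u => (φ u).toReal) u -
        A / 2 * ((u - 1) * (2 + b * (u - 1))) / (1 + b * (u - 1)) ^ 2)
      (secondDeriv φ u - A / (1 + b * (u - 1)) ^ 3) u := by
    intro u hu
    have hu0 : 1 + b * (u - 1) ≠ 0 := ne_of_gt hu.2
    have hnum : HasDerivAt (fun u => A / 2 * ((u - 1) * (2 + b * (u - 1))))
        (A / 2 * (1 * (2 + b * (u - 1)) + (u - 1) * b)) u := by
      have h3 : HasDerivAt (fun u => 2 + b * (u - 1)) b u := by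
        simpa using (((hasDerivAt_id u).sub_const 1).const_mul b).const_add 2
      exact (((hasDerivAt_id u).sub_const 1).mul h3).const_mul (A / 2)
    refine ((h2 u hu.1).2.hasDerivAt.sub
      (hnum.div ((hlin u).fun_pow 2) (pow_ne_zero 2 hu0))).congr_deriv ?_
    rw [secondDeriv]
    field_simp
    ring
  have := le_of_deriv_eq_zero_of_deriv2_nonneg hSc hSo hf hf'
    (fun u hu => sub_nonneg.2 (hA u hu.1 hu.2)) (a := 1) ⟨hφ.one_mem, by simp⟩
    (by simp [hφ.deriv_one]) (x := x) ⟨hx, hw⟩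
  simpa [hφ.toReal_one] using this

/-- The curvature bound is known only at interior points with positive weight. Moving along the
segment from 1 to `x` and using `φ(1 + s (x - 1)) ≤ s φ(x)` transfers it to boundary points and
shows that the weight is positive on the whole domain. -/
theorem rationalLowerBound (hφ : IsGenerator φ) (h2 : TwiceDifferentiable φ) {A b : ℝ}
    (hA0 : 0 < A) (hA : ∀ x ∈ interior (effDom φ), 0 < 1 + b * (x - 1) →
      A / (1 + b * (x - 1)) ^ 3 ≤ secondDeriv φ x) : RationalLowerBound φ (A / 2) b := by
  intro x hx
  have hpt : ∀ s : ℝ, 0 < s → s < 1 → 0 < 1 + s * (b * (x - 1)) →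
      s * (A / 2 * (x - 1) ^ 2) ≤ (1 + s * (b * (x - 1))) * (φ x).toReal := by
    intro s hs0 hs1 hw
    have e : 1 + b * (1 + s * (x - 1) - 1) = 1 + s * (b * (x - 1)) := by ring
    have h := (hφ.le_toReal_of_le_secondDeriv h2 hA (hφ.segment_mem_interior hx hs0.le hs1)
      (by rwa [e])).trans (hφ.toReal_segment_le hx hs0.le hs1.le)
    rw [e, div_le_iff₀ hw] at h
    refine le_of_mul_le_mul_left ?_ hs0
    linarith
  have hlim : ∀ s₀ : ℝ, 0 < s₀ → s₀ ≤ 1 →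
      (∀ s, 0 < s → s < s₀ → 0 < 1 + s * (b * (x - 1))) →
      s₀ * (A / 2 * (x - 1) ^ 2) ≤ (1 + s₀ * (b * (x - 1))) * (φ x).toReal := by
    intro s₀ h0 h1 hw
    have t1 : Tendsto (fun s : ℝ => s * (A / 2 * (x - 1) ^ 2)) (𝓝[<] s₀)
        (𝓝 (s₀ * (A / 2 * (x - 1) ^ 2))) :=
      tendsto_nhdsWithin_of_tendsto_nhds (Continuous.tendsto (by fun_prop) s₀)
    have t2 : Tendsto (fun s : ℝ => (1 + s * (b * (x - 1))) * (φ x).toReal) (𝓝[<] s₀)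
        (𝓝 ((1 + s₀ * (b * (x - 1))) * (φ x).toReal)) :=
      tendsto_nhdsWithin_of_tendsto_nhds (Continuous.tendsto (by fun_prop) s₀)
    refine le_of_tendsto_of_tendsto t1 t2 ?_
    filter_upwards [Ioo_mem_nhdsLT h0] with s hs
    exact hpt s hs.1 (hs.2.trans_le h1) (hw s hs.1 hs.2)
  -- Otherwise the weight vanishes at some `s₀ ≤ 1` on the segment; there the minorant has a pole,
  -- whereas `φ(x)` is finite.
  have hpos : 0 < 1 + b * (x - 1) := by
    by_contra hneg
    have hb : b * (x - 1) ≤ -1 := by linarith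
    have hx1 : x - 1 ≠ 0 := by rintro h0; rw [h0] at hb; norm_num at hb
    have hs0 : 0 < -1 / (b * (x - 1)) := div_pos_of_neg_of_neg (by norm_num) (by linarith)
    have hmul : -1 / (b * (x - 1)) * (b * (x - 1)) = -1 :=
      div_mul_cancel₀ _ (by linarith)
    have := hlim (-1 / (b * (x - 1))) hs0
      (by rw [div_le_iff_of_neg (by linarith)]; linarith) (fun s _ hs => by nlinarith)
    rw [hmul] at this
    have h3 : 0 < -1 / (b * (x - 1)) * (A / 2 * (x - 1) ^ 2) := by positivity
    linarith
  refine ⟨hpos, ?_⟩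
  have := hlim 1 one_pos le_rfl fun s hs0 hs1 => by
    nlinarith [mul_pos hs0 hpos]
  linarith

end IsGenerator

/-! ### The two curvature conditions -/

theorem ThirdOrderCondition.exists_rationalLowerBound {φ : ℝ → ℝ≥0∞} (hφ : IsGenerator φ)
    (h : ThirdOrderCondition φ) : ∃ b, RationalLowerBound φ (secondDeriv φ 1 / 2) b := by
  refine ⟨-(thirdDeriv φ 1 / secondDeriv φ 1 / 3),
    hφ.rationalLowerBound h.twiceDiff h.secondDeriv_one_pos fun x hx _ => ?_⟩
  have := h.comparison (x - 1) (by linarith [hφ.nonneg_of_mem_effDom (interior_subset hx)])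
    (by rwa [add_sub_cancel])
  rw [add_sub_cancel] at this
  convert this using 1
  have e : 3 - (x - 1) * thirdDeriv φ 1 / secondDeriv φ 1 =
    3 * (1 + -(thirdDeriv φ 1 / secondDeriv φ 1 / 3) * (x - 1)) := by ring
  rw [e, mul_pow, ← div_div]
  norm_num

theorem ConcaveCondition.exists_rationalLowerBound {φ : ℝ → ℝ≥0∞} (hφ : IsGenerator φ)
    (h : ConcaveCondition φ) : ∃ b, RationalLowerBound φ (secondDeriv φ 1 / 2) b := by
  have hA := h.secondDeriv_pos 1 hφ.one_mem
  set A := secondDeriv φ 1 with hA'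
  -- A supporting line at 1, `1 / φ''(x) ≤ 1 / A - k (x - 1)`, takes the place of a third
  -- derivative.
  obtain ⟨k, hk⟩ := h.concave.neg.exists_affine_le_of_mem_interior
    (a := 1) (by rw [interior_interior]; exact hφ.one_mem)
  refine ⟨-(A * k / 3), hφ.rationalLowerBound h.twiceDiff hA fun x hx hw => ?_⟩
  have hpos := h.secondDeriv_pos x hx
  have hkx := hk x hx
  simp only [Pi.neg_apply, ← hA'] at hkx
  have h1 : 1 / secondDeriv φ x ≤ (1 - A * k * (x - 1)) / A := by
    have e : (1 - A * k * (x - 1)) / A = 1 / A - k * (x - 1) := by field_simp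
    linarith
  rw [div_le_div_iff₀ hpos hA] at h1
  -- Bernoulli: `(1 + v)³ - (1 + 3 v) = v² (v + 3)`, with `1 + v > 0`.
  have h2 : 1 - A * k * (x - 1) ≤ (1 + -(A * k / 3) * (x - 1)) ^ 3 := by
    have : 0 ≤ (A * k / 3 * (x - 1)) ^ 2 * (1 + -(A * k / 3) * (x - 1) + 2) :=
      mul_nonneg (sq_nonneg _) (by linarith)
    nlinarith
  rw [div_le_iff₀ (pow_pos hw 3)]
  linarith [mul_le_mul_of_nonneg_right h2 hpos.le]

/-- A single test point is enough: `ψ*(y) ≥ y ε / 2 - φ(1 + ε / 2)`, with `φ` finite there. -/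
lemma IsGenerator.psiStarBlowsUp_of_slopeAtTop_eq_top {φ : ℝ → ℝ≥0∞} (hφ : IsGenerator φ)
    (h : slopeAtTop φ = ⊤) : PsiStarBlowsUp φ := by
  obtain ⟨ε, hε, hball⟩ := Metric.mem_nhds_iff.1 (mem_interior_iff_mem_nhds.1 hφ.one_mem)
  have hdom : φ (ε / 2 + 1) ≠ ⊤ := hball (by
    rw [Metric.mem_ball, Real.dist_eq, add_sub_cancel_right, abs_of_pos (by positivity)]
    linarith)
  rw [PsiStarBlowsUp, h, EReal.coe_ennreal_top, EReal.tendsto_nhds_top_iff_real]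
  intro M
  set C := (φ (ε / 2 + 1)).toReal with hC
  have hmem : Ioi (((M + C) / (ε / 2) : ℝ) : EReal) ∈ 𝓝[<] (⊤ : EReal) :=
    mem_nhdsWithin_of_mem_nhds (Ioi_mem_nhds (EReal.coe_lt_top _))
  filter_upwards [preimage_mem_comap hmem] with y hy
  rw [mem_preimage, mem_Ioi, EReal.coe_lt_coe_iff, div_lt_iff₀ (by positivity)] at hy
  refine lt_of_lt_of_le ?_ (le_iSup _ (ε / 2))
  beta_reduce
  rw [← ENNReal.ofReal_toReal hdom, EReal.coe_ennreal_ofReal,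
    max_eq_left ENNReal.toReal_nonneg, ← EReal.coe_sub, EReal.coe_lt_coe_iff]
  linarith

/-! ### Optimality of the constant -/

/-- Second-order Taylor expansion at a critical point, with Peano remainder. -/
lemma eventually_abs_sub_le_of_differentiableAt_deriv {f : ℝ → ℝ} {a : ℝ}
    (hf : ∀ᶠ x in 𝓝 a, DifferentiableAt ℝ f x) (hf' : DifferentiableAt ℝ (deriv f) a)
    (h0 : deriv f a = 0) {η : ℝ} (hη : 0 < η) :
    ∀ᶠ x in 𝓝 a, |f x - f a - deriv (deriv f) a / 2 * (x - a) ^ 2| ≤ η * (x - a) ^ 2 := by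
  set B := deriv (deriv f) a
  have hlo := (hasDerivAt_iff_isLittleO.1 hf'.hasDerivAt).def hη
  obtain ⟨δ, hδ, hball⟩ := Metric.mem_nhds_iff.1 (hf.and hlo)
  filter_upwards [Metric.ball_mem_nhds a hδ] with x hx
  have hsub : Metric.closedBall a |x - a| ⊆ Metric.ball a δ :=
    Metric.closedBall_subset_ball hx
  -- Mean value inequality for `f(y) - B (y - a)² / 2`, whose derivative is at most `η |x - a|` in
  -- absolute value on the closed ball of radius `|x - a|`.
  have key := Convex.norm_image_sub_le_of_norm_hasDerivWithin_le (𝕜 := ℝ)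
    (f := fun y => f y - B / 2 * (y - a) ^ 2) (f' := fun y => deriv f y - B * (y - a))
    (s := Metric.closedBall a |x - a|) (C := η * |x - a|) (x := a) (y := x)
    (fun y hy => by
      refine HasDerivAt.hasDerivWithinAt
        ((((hball (hsub hy)).1.hasDerivAt).sub
          (((hasDerivAt_id' y).sub_const a).fun_pow 2 |>.const_mul (B / 2))).congr_deriv ?_)
      ring)
    (fun y hy => by
      have h1 := (hball (hsub hy)).2
      rw [h0, smul_eq_mul, sub_zero, mul_comm] at h1
      exact h1.trans (mul_le_mul_of_nonneg_left hy hη.le))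
    (convex_closedBall _ _) (Metric.mem_closedBall_self (abs_nonneg _))
    (by rw [Metric.mem_closedBall, Real.dist_eq])
  rw [Real.norm_eq_abs, Real.norm_eq_abs, mul_assoc, abs_mul_abs_self] at key
  convert key using 1
  · congr 1; ring
  · ring

lemma IsGenerator.le_half_secondDeriv {φ : ℝ → ℝ≥0∞} (hφ : IsGenerator φ)
    (h1 : ∀ᶠ x in 𝓝 (1 : ℝ), DifferentiableAt ℝ (fun y => (φ y).toReal) x)
    (h2 : DifferentiableAt ℝ (deriv fun y => (φ y).toReal) 1) {K : ℝ}
    (hK : ∀ ε : ℝ, 0 < ε → ε < 1 →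
      ENNReal.ofReal (K * ε ^ 2) ≤ 2⁻¹ * (φ (1 + ε) + φ (1 - ε))) :
    K ≤ secondDeriv φ 1 / 2 := by
  refine le_of_forall_pos_le_add fun η hη => ?_
  have hT := eventually_abs_sub_le_of_differentiableAt_deriv h1 h2 hφ.deriv_one hη
  have hdom : ∀ᶠ x in 𝓝 (1 : ℝ), x ∈ effDom φ := mem_interior_iff_mem_nhds.1 hφ.one_mem
  obtain ⟨δ, hδ, hball⟩ := Metric.mem_nhds_iff.1 (hT.and hdom)
  obtain ⟨ε, hε0, hε⟩ := exists_between (lt_min hδ one_pos)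
  have hp : 1 + ε ∈ Metric.ball (1 : ℝ) δ := by
    rw [Metric.mem_ball, Real.dist_eq, add_sub_cancel_left, abs_of_pos hε0]
    exact hε.trans_le (min_le_left _ _)
  have hm : 1 - ε ∈ Metric.ball (1 : ℝ) δ := by
    rw [Metric.mem_ball, Real.dist_eq, sub_sub_cancel_left, abs_neg, abs_of_pos hε0]
    exact hε.trans_le (min_le_left _ _)
  obtain ⟨hp1, hp2⟩ := hball hp
  obtain ⟨hm1, hm2⟩ := hball hm
  have hle := hK ε hε0 (hε.trans_le (min_le_right _ _))
  -- Only the right side has to be nonnegative to descend to the reals, so `K` may have any sign.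
  rw [← ENNReal.ofReal_toReal hp2, ← ENNReal.ofReal_toReal hm2,
    ← ENNReal.ofReal_add ENNReal.toReal_nonneg ENNReal.toReal_nonneg,
    show (2⁻¹ : ℝ≥0∞) = ENNReal.ofReal 2⁻¹ by
      rw [ENNReal.ofReal_inv_of_pos two_pos, ENNReal.ofReal_ofNat],
    ← ENNReal.ofReal_mul (by norm_num), ENNReal.ofReal_le_ofReal_iff (by positivity)] at hle
  simp only [hφ.toReal_one, add_sub_cancel_left, sub_sub_cancel_left, sub_zero] at hp1 hm1
  have hp3 := (abs_le.1 hp1).2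
  have hm3 := (abs_le.1 hm1).2
  rw [secondDeriv]
  refine le_of_mul_le_mul_right ?_ (pow_pos hε0 2)
  nlinarith

/-- Take `ν = (δ_a + δ_b) / 2` with `a ∈ A`, `b ∉ A`, and let `μ` have density `1 + ε` on `A` and `1
- ε` off it. Singletons need not be measurable; `A` alone separates the two points. -/
lemma exists_phiDiv_eq_and_tvDist_eq {Ω : Type*} [MeasurableSpace Ω] {A : Set Ω}
    (hA : MeasurableSet A) (hA0 : A ≠ ∅) (hA1 : A ≠ univ) (φ : ℝ → ℝ≥0∞) {ε : ℝ} (h0 : 0 < ε)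
    (h1 : ε < 1) : ∃ μ ν : Measure Ω, IsProbabilityMeasure μ ∧ IsProbabilityMeasure ν ∧
      phiDiv φ μ ν = 2⁻¹ * (φ (1 + ε) + φ (1 - ε)) ∧ tvDist μ ν = ε := by
  classical
  obtain ⟨a, ha⟩ := nonempty_iff_ne_empty.2 hA0
  obtain ⟨b, hb⟩ := (ne_univ_iff_exists_notMem A).1 hA1
  set ν : Measure Ω := (2⁻¹ : ℝ≥0∞) • (Measure.dirac a + Measure.dirac b) with hν
  have hlin : ∀ h : Ω → ℝ≥0∞, Measurable h → ∫⁻ ω, h ω ∂ν = 2⁻¹ * (h a + h b) := by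
    intro h hh
    rw [hν, lintegral_smul_measure, lintegral_add_measure, lintegral_dirac' _ hh,
      lintegral_dirac' _ hh, smul_eq_mul]
  have hνp : IsProbabilityMeasure ν := ⟨by
    rw [← lintegral_one, hlin _ measurable_const, one_add_one_eq_two]
    exact ENNReal.inv_mul_cancel two_ne_zero ENNReal.ofNat_ne_top⟩
  have hint : ∀ h : Ω → ℝ, Measurable h → ∫ ω, h ω ∂ν = 2⁻¹ * (h a + h b) := by
    intro h hh
    have hi : ∀ c : Ω, Integrable h (Measure.dirac c) := fun c => by
      refine ⟨hh.aestronglyMeasurable, ?_⟩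
      rw [hasFiniteIntegral_iff_enorm, lintegral_dirac' _ hh.enorm]
      exact enorm_lt_top
    rw [hν, integral_smul_measure, integral_add_measure (hi a) (hi b),
      integral_dirac' _ _ hh.stronglyMeasurable, integral_dirac' _ _ hh.stronglyMeasurable]
    simp
  set f : Ω → ℝ := A.piecewise (fun _ => 1 + ε) (fun _ => 1 - ε) with hf
  have hfm : Measurable f := measurable_const.piecewise hA measurable_const
  have hfa : f a = 1 + ε := piecewise_eq_of_mem _ _ _ ha
  have hfb : f b = 1 - ε := piecewise_eq_of_notMem _ _ _ hb
  have hf0 : ∀ ω, 0 ≤ f ω := fun ω => by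
    by_cases hω : ω ∈ A <;> simp [hf, hω] <;> linarith
  -- `φ` is arbitrary, but `φ ∘ f` takes only two values.
  have hφf : Measurable fun ω => φ (f ω) := by
    have : (fun ω => φ (f ω)) = A.piecewise (fun _ => φ (1 + ε)) (fun _ => φ (1 - ε)) := by
      ext ω
      by_cases hω : ω ∈ A <;> simp [hf, hω]
    rw [this]
    exact measurable_const.piecewise hA measurable_const
  set μ : Measure Ω := ν.withDensity fun ω => ENNReal.ofReal (f ω) with hμ
  have hμp : IsProbabilityMeasure μ := ⟨by
    rw [hμ, withDensity_apply _ MeasurableSet.univ, Measure.restrict_univ,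
      hlin _ hfm.ennreal_ofReal, ← ENNReal.ofReal_add (hf0 a) (hf0 b), hfa, hfb,
      show 1 + ε + (1 - ε) = 2 by ring, ENNReal.ofReal_ofNat]
    exact ENNReal.inv_mul_cancel two_ne_zero ENNReal.ofNat_ne_top⟩
  have hrn : ∀ᵐ ω ∂ν, (μ.rnDeriv ν ω).toReal = f ω := by
    filter_upwards [Measure.rnDeriv_withDensity ν hfm.ennreal_ofReal] with ω hω
    rw [hω, ENNReal.toReal_ofReal (hf0 ω)]
  have hsing : μ.singularPart ν = 0 :=
    Measure.singularPart_eq_zero_of_ac (withDensity_absolutelyContinuous _ _)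
  refine ⟨μ, ν, hμp, hνp, ?_, le_antisymm ?_ ?_⟩
  · rw [phiDiv, hsing, lintegral_congr_ae (hrn.mono fun ω hω => congrArg φ hω), hlin _ hφf,
      hfa, hfb]
    simp
  · refine (tvDist_le μ ν).trans (le_of_eq ?_)
    rw [hsing, integral_congr_ae (hrn.mono fun ω hω => congrArg (fun x => |x - 1|) hω),
      hint _ (by fun_prop), hfa, hfb]
    simp [abs_of_pos h0]
    ring
  · set g : Ω → ℝ := A.piecewise (fun _ => 1) (fun _ => -1) with hg
    have hgm : Measurable g := measurable_const.piecewise hA measurable_const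
    have hga : g a = 1 := piecewise_eq_of_mem _ _ _ ha
    have hgb : g b = -1 := piecewise_eq_of_notMem _ _ _ hb
    have hg1 : ∀ ω, g ω ∈ Icc (-1 : ℝ) 1 := fun ω => by
      by_cases hω : ω ∈ A <;> simp [hg, hω]
    have := le_tvDist μ ν hgm hg1
    have hi : Integrable g μ := Integrable.of_mem_Icc (-1) 1 hgm.aemeasurable (ae_of_all _ hg1)
    rw [integral_eq_integral_rnDeriv_mul_add μ ν hi, hsing,
      integral_congr_ae (hrn.mono fun ω hω => congrArg (· * g ω) hω),
      hint (fun ω => f ω * g ω) (hfm.mul hgm), hint _ hgm, hfa, hfb, hga, hgb, integral_zero_measure] at this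
    refine le_trans (le_of_eq ?_) this
    rw [show 2⁻¹ * ((1 + ε) * 1 + (1 - ε) * -1) + 0 - 2⁻¹ * (1 + -1) = ε by ring,
      abs_of_pos h0]

/-! ### Hoeffding's lemma -/

theorem log_integral_exp_le_of_ae_mem_Icc {Ω : Type*} [MeasurableSpace Ω] {ν : Measure Ω}
    [IsProbabilityMeasure ν] {g : Ω → ℝ} {m M : ℝ} (hg : AEMeasurable g ν)
    (hmM : ∀ᵐ ω ∂ν, m ≤ g ω ∧ g ω ≤ M) (t : ℝ) :
    Real.log (∫ ω, Real.exp (t * (g ω - ∫ ω', g ω' ∂ν)) ∂ν) ≤ (M - m) ^ 2 * t ^ 2 / 8 := by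
  -- The variance proxy is `((M - m) / 2)²`, and the cumulant bound is half the proxy times `t²`.
  refine ((ProbabilityTheory.hasSubgaussianMGF_of_mem_Icc hg hmM).cgf_le t).trans (le_of_eq ?_)
  push_cast
  rw [Real.norm_eq_abs, div_pow, sq_abs]
  ring

/-! ### Generators of the α-divergences -/

/-- The real-valued branch of `alphaGen`. -/
noncomputable def alphaReal (α x : ℝ) : ℝ :=
  if α = 0 then x - 1 - Real.log x
  else if α = 1 then x * Real.log x - x + 1
  else (x ^ α - α * (x - 1) - 1) / (α * (α - 1))

/-- The derivative of `alphaReal α` on `(0, ∞)`. -/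
noncomputable def alphaRealDeriv (α x : ℝ) : ℝ :=
  if α = 1 then Real.log x else (x ^ (α - 1) - 1) / (α - 1)

lemma alphaGen_eq_ite (α x : ℝ) :
    alphaGen α x = if x < 0 ∨ (x = 0 ∧ α ≤ 0) then ⊤ else ENNReal.ofReal (alphaReal α x) := by
  unfold alphaGen alphaReal
  split_ifs <;> rfl

lemma hasDerivAt_alphaReal (α : ℝ) {x : ℝ} (hx : 0 < x) :
    HasDerivAt (alphaReal α) (alphaRealDeriv α x) x := by
  unfold alphaReal alphaRealDeriv
  by_cases h0 : α = 0
  · subst h0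
    simp only [if_true, zero_ne_one, if_false]
    refine (((hasDerivAt_id' x).sub_const 1).sub (Real.hasDerivAt_log hx.ne')).congr_deriv ?_
    rw [zero_sub, Real.rpow_neg_one]; ring
  by_cases h1 : α = 1
  · subst h1
    simp only [one_ne_zero, if_true, if_false]
    refine (((Real.hasDerivAt_mul_log hx.ne').sub (hasDerivAt_id' x)).add_const 1).congr_deriv ?_
    ring
  · simp only [h0, h1, if_false]
    have h1' := sub_ne_zero.2 h1
    refine ((((Real.hasDerivAt_rpow_const (p := α) (Or.inl hx.ne')).sub
      (((hasDerivAt_id' x).sub_const 1).const_mul α)).sub_const 1).div_const _).congr_deriv ?_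
    field_simp

lemma hasDerivAt_alphaRealDeriv (α : ℝ) {x : ℝ} (hx : 0 < x) :
    HasDerivAt (alphaRealDeriv α) (x ^ (α - 2)) x := by
  unfold alphaRealDeriv
  by_cases h1 : α = 1
  · subst h1
    simp only [if_true]
    refine (Real.hasDerivAt_log hx.ne').congr_deriv ?_
    rw [← Real.rpow_neg_one]; norm_num
  · simp only [h1, if_false]
    have h1' := sub_ne_zero.2 h1
    refine (((Real.hasDerivAt_rpow_const (p := α - 1) (Or.inl hx.ne')).sub_const 1).div_const
      _).congr_deriv ?_
    rw [mul_div_cancel_left₀ _ h1']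
    congr 1; ring

lemma alphaReal_one (α : ℝ) : alphaReal α 1 = 0 := by simp [alphaReal]

lemma alphaRealDeriv_one (α : ℝ) : alphaRealDeriv α 1 = 0 := by simp [alphaRealDeriv]

/-- Settles the sign at the endpoint, which the derivative argument on `(0, ∞)` does not reach. -/
lemma alphaReal_zero {α : ℝ} (hα : 0 < α) : alphaReal α 0 = α⁻¹ := by
  unfold alphaReal
  rw [if_neg hα.ne']
  split_ifs with h
  · simp [h]
  · have := sub_ne_zero.2 h
    rw [Real.zero_rpow hα.ne']
    field_simp
    ring

lemma alphaReal_nonneg_of_pos (α : ℝ) {x : ℝ} (hx : 0 < x) : 0 ≤ alphaReal α x := by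
  rw [← alphaReal_one α]
  exact le_of_deriv_eq_zero_of_deriv2_nonneg (convex_Ioi 0) isOpen_Ioi
    (fun y hy => hasDerivAt_alphaReal α hy) (fun y hy => hasDerivAt_alphaRealDeriv α hy)
    (fun y hy => Real.rpow_nonneg (le_of_lt hy) _) (a := 1) (mem_Ioi.2 one_pos)
    (alphaRealDeriv_one α) hx

lemma mem_effDom_alphaGen {α x : ℝ} : x ∈ effDom (alphaGen α) ↔ 0 < x ∨ (x = 0 ∧ 0 < α) := by
  rw [effDom, mem_ofPred_eq, alphaGen_eq_ite]
  have : (x < 0 ∨ (x = 0 ∧ α ≤ 0)) ↔ ¬ (0 < x ∨ (x = 0 ∧ 0 < α)) := by grind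
  split_ifs with h
  · simpa using this.1 h
  · simpa using not_not.1 (fun h' => h (this.2 h'))

lemma alphaGen_eq_ofReal {α x : ℝ} (hx : x ∈ effDom (alphaGen α)) :
    alphaGen α x = ENNReal.ofReal (alphaReal α x) := by
  rw [alphaGen_eq_ite, if_neg]
  rw [mem_effDom_alphaGen] at hx
  grind

lemma mem_effDom_alphaGen_of_pos (α : ℝ) {x : ℝ} (hx : 0 < x) : x ∈ effDom (alphaGen α) :=
  mem_effDom_alphaGen.2 (Or.inl hx)

lemma alphaReal_nonneg {α x : ℝ} (hx : x ∈ effDom (alphaGen α)) : 0 ≤ alphaReal α x := by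
  rcases mem_effDom_alphaGen.1 hx with h | ⟨rfl, h⟩
  · exact alphaReal_nonneg_of_pos α h
  · rw [alphaReal_zero h]; positivity

lemma toReal_alphaGen {α x : ℝ} (hx : x ∈ effDom (alphaGen α)) :
    (alphaGen α x).toReal = alphaReal α x := by
  rw [alphaGen_eq_ofReal hx, ENNReal.toReal_ofReal (alphaReal_nonneg hx)]

lemma effDom_alphaGen_subset (α : ℝ) : effDom (alphaGen α) ⊆ Ici 0 := fun x hx => by
  rcases mem_effDom_alphaGen.1 hx with h | ⟨rfl, -⟩
  · exact h.le
  · exact mem_Ici.2 le_rfl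

lemma interior_effDom_alphaGen (α : ℝ) : interior (effDom (alphaGen α)) = Ioi 0 := by
  refine subset_antisymm ?_
    (interior_maximal (fun x hx => mem_effDom_alphaGen_of_pos α hx) isOpen_Ioi)
  rw [← interior_Ici]
  exact interior_mono (effDom_alphaGen_subset α)

lemma convex_effDom_alphaGen (α : ℝ) : Convex ℝ (effDom (alphaGen α)) := by
  rcases lt_or_ge 0 α with h | h
  · rw [show effDom (alphaGen α) = Ici 0 by ext x; rw [mem_effDom_alphaGen, mem_Ici]; grind]
    exact convex_Ici 0
  · rw [show effDom (alphaGen α) = Ioi 0 by ext x; rw [mem_effDom_alphaGen, mem_Ioi]; grind]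
    exact convex_Ioi 0

/-- Continuity on all of `ℝ`, including the totalised values at negative `x`, yields one-sided
continuity at 0. -/
lemma continuous_alphaReal_of_pos {α : ℝ} (hα : 0 < α) : Continuous (alphaReal α) := by
  unfold alphaReal
  simp only [hα.ne', if_false]
  split_ifs
  · exact (Real.continuous_mul_log.sub continuous_id).add_const 1
  · have := Real.continuous_rpow_const hα.le
    fun_prop

lemma tendsto_alphaReal_nhdsGT_zero {α : ℝ} (hα : α ≤ 0) :
    Tendsto (alphaReal α) (𝓝[>] 0) atTop := by
  unfold alphaReal
  rcases hα.eq_or_lt with rfl | hα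
  · simp only [if_true]
    have h1 : Tendsto (fun x : ℝ => x - 1) (𝓝[>] 0) (𝓝 (0 - 1)) :=
      tendsto_nhdsWithin_of_tendsto_nhds (Continuous.tendsto (by fun_prop) 0)
    exact h1.add_atTop (tendsto_neg_atBot_atTop.comp Real.tendsto_log_nhdsGT_zero)
  · simp only [hα.ne, (by linarith : α < 1).ne, if_false]
    have h1 : Tendsto (fun x : ℝ => -α * (x - 1) - 1) (𝓝[>] 0) (𝓝 (-α * (0 - 1) - 1)) :=
      tendsto_nhdsWithin_of_tendsto_nhds (Continuous.tendsto (by fun_prop) 0)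
    refine Tendsto.atTop_div_const (mul_pos_of_neg_of_neg hα (by linarith)) ?_
    refine (h1.add_atTop (tendsto_rpow_neg_nhdsGT_zero hα)).congr fun x => ?_
    ring

lemma strictConvexOn_toReal_alphaGen (α : ℝ) :
    StrictConvexOn ℝ (effDom (alphaGen α)) fun x => (alphaGen α x).toReal := by
  have : StrictConvexOn ℝ (effDom (alphaGen α)) (alphaReal α) := by
    refine strictConvexOn_of_deriv2_pos (convex_effDom_alphaGen α) (fun x hx => ?_) fun x hx => ?_
    · rcases mem_effDom_alphaGen.1 hx with h | ⟨-, h⟩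
      · exact (hasDerivAt_alphaReal α h).continuousAt.continuousWithinAt
      · exact (continuous_alphaReal_of_pos h).continuousWithinAt
    · rw [interior_effDom_alphaGen] at hx
      have : deriv (alphaReal α) =ᶠ[𝓝 x] alphaRealDeriv α := by
        filter_upwards [Ioi_mem_nhds hx] with y hy
        exact (hasDerivAt_alphaReal α hy).deriv
      rw [Function.iterate_succ, Function.iterate_one, Function.comp_apply, this.deriv_eq,
        (hasDerivAt_alphaRealDeriv α hx).deriv]
      exact Real.rpow_pos_of_pos hx _
  exact this.congr fun x hx => (toReal_alphaGen hx).symm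

lemma toReal_alphaGen_eventuallyEq (α : ℝ) {x : ℝ} (hx : 0 < x) :
    (fun y => (alphaGen α y).toReal) =ᶠ[𝓝 x] alphaReal α := by
  filter_upwards [Ioi_mem_nhds hx] with y hy
  exact toReal_alphaGen (mem_effDom_alphaGen_of_pos α hy)

lemma hasDerivAt_toReal_alphaGen (α : ℝ) {x : ℝ} (hx : 0 < x) :
    HasDerivAt (fun y => (alphaGen α y).toReal) (alphaRealDeriv α x) x :=
  (hasDerivAt_alphaReal α hx).congr_of_eventuallyEq (toReal_alphaGen_eventuallyEq α hx)

lemma hasDerivAt_deriv_toReal_alphaGen (α : ℝ) {x : ℝ} (hx : 0 < x) :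
    HasDerivAt (deriv fun y => (alphaGen α y).toReal) (x ^ (α - 2)) x := by
  refine (hasDerivAt_alphaRealDeriv α hx).congr_of_eventuallyEq ?_
  filter_upwards [Ioi_mem_nhds hx] with y hy
  exact (hasDerivAt_toReal_alphaGen α hy).deriv

lemma secondDeriv_alphaGen (α : ℝ) {x : ℝ} (hx : 0 < x) :
    secondDeriv (alphaGen α) x = x ^ (α - 2) :=
  (hasDerivAt_deriv_toReal_alphaGen α hx).deriv

lemma secondDeriv_alphaGen_one (α : ℝ) : secondDeriv (alphaGen α) 1 = 1 := by
  rw [secondDeriv_alphaGen α one_pos, Real.one_rpow]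

lemma hasDerivAt_secondDeriv_alphaGen_one (α : ℝ) :
    HasDerivAt (secondDeriv (alphaGen α)) (α - 2) 1 := by
  have : HasDerivAt (fun x : ℝ => x ^ (α - 2)) (α - 2) 1 := by
    simpa using Real.hasDerivAt_rpow_const (x := 1) (p := α - 2) (Or.inl one_ne_zero)
  refine this.congr_of_eventuallyEq ?_
  filter_upwards [Ioi_mem_nhds one_pos] with y hy
  exact secondDeriv_alphaGen α hy

lemma lowerSemicontinuous_alphaGen (α : ℝ) : LowerSemicontinuous (alphaGen α) := by
  intro x y hy
  rcases lt_trichotomy x 0 with hx | rfl | hx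
  · filter_upwards [Iio_mem_nhds hx] with z hz
    rw [alphaGen_eq_ite, if_pos (Or.inl (mem_Iio.1 hz))]
    exact lt_top_of_lt hy
  · rw [← nhdsLT_sup_nhdsGE, eventually_sup]
    constructor
    · filter_upwards [self_mem_nhdsWithin] with z hz
      rw [alphaGen_eq_ite, if_pos (Or.inl (mem_Iio.1 hz))]
      exact lt_top_of_lt hy
    -- At 0 from the right: `φ_α` is continuous if `α > 0`, and tends to its value `⊤` if `α ≤ 0`.
    · rcases lt_or_ge 0 α with hα | hα
      · have hmem : ∀ z ∈ Ici (0 : ℝ), z ∈ effDom (alphaGen α) := fun z hz =>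
          mem_effDom_alphaGen.2 (hz.lt_or_eq.imp id fun h => ⟨h.symm, hα⟩)
        rw [alphaGen_eq_ofReal (hmem 0 self_mem_Ici)] at hy
        have ht := ((ENNReal.continuous_ofReal.comp
          (continuous_alphaReal_of_pos hα)).tendsto 0).eventually (lt_mem_nhds hy)
        filter_upwards [mem_nhdsWithin_of_mem_nhds ht, self_mem_nhdsWithin] with z hz hz0
        rw [alphaGen_eq_ofReal (hmem z hz0)]
        exact hz
      · rw [← Ioi_insert, nhdsWithin_insert, eventually_sup]
        refine ⟨hy, ?_⟩
        have ht := (ENNReal.tendsto_ofReal_atTop.comp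
          (tendsto_alphaReal_nhdsGT_zero hα)).eventually (lt_mem_nhds (lt_top_of_lt hy))
        filter_upwards [ht, self_mem_nhdsWithin] with z hz hz0
        rw [alphaGen_eq_ofReal (mem_effDom_alphaGen_of_pos α hz0)]
        exact hz
  · have hc : ContinuousAt (fun z => ENNReal.ofReal (alphaReal α z)) x :=
      ENNReal.continuous_ofReal.continuousAt.comp (hasDerivAt_alphaReal α hx).continuousAt
    rw [alphaGen_eq_ofReal (mem_effDom_alphaGen_of_pos α hx)] at hy
    filter_upwards [hc.eventually (lt_mem_nhds hy), Ioi_mem_nhds hx] with z hz hz0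
    rw [alphaGen_eq_ofReal (mem_effDom_alphaGen_of_pos α hz0)]
    exact hz

lemma ennreal_convex_of_convexOn_toReal {φ : ℝ → ℝ≥0∞}
    (h : ConvexOn ℝ (effDom φ) fun x => (φ x).toReal) (x y : ℝ) (a b : ℝ≥0) (hab : a + b = 1) :
    φ ((a : ℝ) * x + (b : ℝ) * y) ≤ (a : ℝ≥0∞) * φ x + (b : ℝ≥0∞) * φ y := by
  -- Zero weights are treated apart because `0 * ⊤ = 0`.
  rcases eq_or_ne a 0 with rfl | ha
  · obtain rfl : b = 1 := by simpa using hab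
    simp
  rcases eq_or_ne b 0 with rfl | hb
  · obtain rfl : a = 1 := by simpa using hab
    simp
  by_cases hx : φ x = ⊤
  · simp [hx, ENNReal.mul_top, ha]
  by_cases hy : φ y = ⊤
  · simp [hy, ENNReal.mul_top, hb]
  have hab' : (a : ℝ) + b = 1 := by exact_mod_cast hab
  have hmem := h.1 hx hy a.2 b.2 hab'
  have hle := h.2 hx hy a.2 b.2 hab'
  simp only [smul_eq_mul, NNReal.val_eq_coe] at hmem hle
  rw [← ENNReal.ofReal_toReal hmem]
  refine (ENNReal.ofReal_le_ofReal hle).trans (le_of_eq ?_)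
  rw [ENNReal.ofReal_add (by positivity) (by positivity), ENNReal.ofReal_mul a.coe_nonneg,
    ENNReal.ofReal_mul b.coe_nonneg, ENNReal.ofReal_toReal hx, ENNReal.ofReal_toReal hy,
    ENNReal.ofReal_coe_nnreal, ENNReal.ofReal_coe_nnreal]

lemma isGenerator_alphaGen (α : ℝ) : IsGenerator (alphaGen α) where
  convex := ennreal_convex_of_convexOn_toReal (strictConvexOn_toReal_alphaGen α).convexOn
  lsc := lowerSemicontinuous_alphaGen α
  map_one := by
    rw [alphaGen_eq_ofReal (mem_effDom_alphaGen_of_pos α one_pos), alphaReal_one,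
      ENNReal.ofReal_zero]
  eq_top_of_neg x hx := by rw [alphaGen_eq_ite, if_pos (Or.inl hx)]
  one_mem := by rw [interior_effDom_alphaGen]; exact mem_Ioi.2 one_pos

lemma twiceDifferentiable_alphaGen (α : ℝ) : TwiceDifferentiable (alphaGen α) := by
  intro x hx
  rw [interior_effDom_alphaGen] at hx
  exact ⟨(hasDerivAt_toReal_alphaGen α hx).differentiableAt,
    (hasDerivAt_deriv_toReal_alphaGen α hx).differentiableAt⟩

lemma thirdOrderCondition_alphaGen {α : ℝ} (h1 : -1 ≤ α) (h2 : α ≤ 2) :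
    ThirdOrderCondition (alphaGen α) where
  strictConvex := strictConvexOn_toReal_alphaGen α
  twiceDiff := twiceDifferentiable_alphaGen α
  thriceDiffAtOne := (hasDerivAt_secondDeriv_alphaGen_one α).differentiableAt
  secondDeriv_one_pos := by rw [secondDeriv_alphaGen_one]; exact one_pos
  comparison z _ hz := by
    rw [interior_effDom_alphaGen, mem_Ioi] at hz
    rw [secondDeriv_alphaGen_one, secondDeriv_alphaGen α hz, thirdDeriv,
      (hasDerivAt_secondDeriv_alphaGen_one α).deriv, div_one, mul_one]
    -- Bernoulli for the exponent `(2 - α) / 3`, which lies in `[0, 1]` exactly when `-1 ≤ α ≤ 2`;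
    -- its cube is the reciprocal of the comparison inequality.
    have hB := rpow_one_add_le_one_add_mul_self (s := z) (p := (2 - α) / 3) (by linarith)
      (by linarith) (by linarith)
    have hpos : 0 < (1 + z) ^ ((2 - α) / 3) := Real.rpow_pos_of_pos hz _
    have h3 : ((1 + z) ^ ((2 - α) / 3)) ^ 3 = (1 + z) ^ (2 - α) := by
      rw [← Real.rpow_natCast, ← Real.rpow_mul hz.le]
      congr 1; push_cast; ring
    have hB3 := pow_le_pow_left₀ hpos.le hB 3
    rw [h3] at hB3
    have hden : (3 - z * (α - 2)) ^ 3 = 27 * (1 + (2 - α) / 3 * z) ^ 3 := by ring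
    rw [hden, ← div_div, div_self (by norm_num), show α - 2 = -(2 - α) by ring,
      Real.rpow_neg hz.le, one_div]
    exact inv_anti₀ (Real.rpow_pos_of_pos hz _) hB3

lemma slopeAtTop_alphaGen {α : ℝ} (hα : 1 ≤ α) : slopeAtTop (alphaGen α) = ⊤ := by
  have hreal : Tendsto (fun x => alphaReal α x / x) atTop atTop := by
    have hinv := tendsto_inv_atTop_zero (𝕜 := ℝ)
    rcases hα.eq_or_lt with rfl | hα
    · refine ((hinv.const_add (-1)).add_atTop Real.tendsto_log_atTop).congr' ?_
      filter_upwards [eventually_gt_atTop 0] with x hx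
      rw [alphaReal, if_neg one_ne_zero, if_pos rfl]
      field_simp
      ring
    · have h0 : 0 < α * (α - 1) := mul_pos (by linarith) (by linarith)
      refine ((((hinv.const_mul (α - 1)).const_add (-α)).add_atTop
        (tendsto_rpow_atTop (y := α - 1) (by linarith))).atTop_div_const h0).congr' ?_
      filter_upwards [eventually_gt_atTop 0] with x hx
      rw [alphaReal, if_neg (by linarith), if_neg hα.ne', Real.rpow_sub_one hx.ne']
      field_simp
      ring
  rw [slopeAtTop]
  refine (Tendsto.congr' ?_ (ENNReal.tendsto_ofReal_atTop.comp hreal)).limsup_eq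
  filter_upwards [eventually_gt_atTop 0] with x hx
  rw [Function.comp_apply, alphaGen_eq_ofReal (mem_effDom_alphaGen_of_pos α hx),
    ENNReal.ofReal_div_of_pos hx]

lemma concaveCondition_alphaGen {α : ℝ} (h1 : 1 ≤ α) (h2 : α ≤ 2) :
    ConcaveCondition (alphaGen α) where
  strictConvex := strictConvexOn_toReal_alphaGen α
  twiceDiff := twiceDifferentiable_alphaGen α
  secondDeriv_pos x hx := by
    rw [interior_effDom_alphaGen] at hx
    rw [secondDeriv_alphaGen α hx]
    exact Real.rpow_pos_of_pos hx _
  concave := by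
    rw [interior_effDom_alphaGen]
    -- `1 / φ_α'' = x ^ (2 - α)` is concave because `0 ≤ 2 - α ≤ 1`.
    refine ((Real.concaveOn_rpow (p := 2 - α) (by linarith) (by linarith)).subset
      Ioi_subset_Ici_self (convex_Ioi 0)).congr fun x hx => ?_
    simp only
    rw [secondDeriv_alphaGen α hx, one_div, ← Real.rpow_neg (le_of_lt hx), neg_sub]
  blowsUp := (isGenerator_alphaGen α).psiStarBlowsUp_of_slopeAtTop_eq_top (slopeAtTop_alphaGen h1)

/-! ### Kullback-Leibler divergence and the main theorem -/

/-- Under absolute continuity the integrands agree; otherwise the right side is `⊤`. Pinsker needs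
only this direction. -/
lemma phiDiv_alphaGen_one_le_klDiv {Ω : Type*} [MeasurableSpace Ω] (μ ν : Measure Ω)
    [IsFiniteMeasure μ] [IsFiniteMeasure ν] :
    phiDiv (alphaGen 1) μ ν ≤ InformationTheory.klDiv μ ν := by
  rw [InformationTheory.klDiv_eq_lintegral_klFun]
  split_ifs with hac
  · rw [phiDiv, Measure.singularPart_eq_zero_of_ac hac]
    simp only [Measure.coe_zero, Pi.zero_apply, zero_mul, add_zero]
    refine lintegral_mono fun ω => ?_
    rw [alphaGen_eq_ofReal (mem_effDom_alphaGen.2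
      (ENNReal.toReal_nonneg.lt_or_eq.imp id fun h => ⟨h.symm, one_pos⟩)), alphaReal,
      if_neg one_ne_zero, if_pos rfl, InformationTheory.klFun]
    exact ENNReal.ofReal_le_ofReal (by linarith)
  · exact le_top

theorem mainTheorem11 {Ω : Type*} [MeasurableSpace Ω] :
    -- third-order comparison
    (∀ φ : ℝ → ℝ≥0∞, IsGenerator φ → ThirdOrderCondition φ →
      (∀ t : ℝ, 0 ≤ t →
        heightForWidth (psiStar φ) t ≤ ENNReal.ofReal (t ^ 2 / (8 * secondDeriv φ 1))) ∧
      ∀ μ ν : Measure Ω, IsProbabilityMeasure μ → IsProbabilityMeasure ν →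
        ENNReal.ofReal (secondDeriv φ 1 / 2 * tvDist μ ν ^ 2) ≤ phiDiv φ μ ν) ∧
    -- concavity of `1 / φ''`
    (∀ φ : ℝ → ℝ≥0∞, IsGenerator φ → ConcaveCondition φ →
      (∀ t : ℝ, 0 ≤ t →
        heightForWidth (psiStar φ) t ≤ ENNReal.ofReal (t ^ 2 / (8 * secondDeriv φ 1))) ∧
      ∀ μ ν : Measure Ω, IsProbabilityMeasure μ → IsProbabilityMeasure ν →
        ENNReal.ofReal (secondDeriv φ 1 / 2 * tvDist μ ν ^ 2) ≤ phiDiv φ μ ν) ∧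
    -- `φ'(∞) = ∞` suffices for the blow-up condition
    (∀ φ : ℝ → ℝ≥0∞, IsGenerator φ → slopeAtTop φ = ⊤ → PsiStarBlowsUp φ) ∧
    -- the constant `φ''(1) / 2` is optimal
    (∀ φ : ℝ → ℝ≥0∞, IsGenerator φ →
      (∀ᶠ x in 𝓝 (1 : ℝ), DifferentiableAt ℝ (fun y => (φ y).toReal) x) →
      DifferentiableAt ℝ (deriv fun y => (φ y).toReal) 1 →
      (∃ A : Set Ω, MeasurableSet A ∧ A ≠ ∅ ∧ A ≠ univ) →
      ∀ K : ℝ,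
        (∀ μ ν : Measure Ω, IsProbabilityMeasure μ → IsProbabilityMeasure ν →
          ENNReal.ofReal (K * tvDist μ ν ^ 2) ≤ phiDiv φ μ ν) →
        K ≤ secondDeriv φ 1 / 2) ∧
    -- `α`-divergences, `-1 ≤ α ≤ 2`
    (∀ α : ℝ, -1 ≤ α → α ≤ 2 →
      IsGenerator (alphaGen α) ∧ ThirdOrderCondition (alphaGen α) ∧
      (1 ≤ α → ConcaveCondition (alphaGen α)) ∧
      (∀ t : ℝ, 0 ≤ t →
        heightForWidth (psiStar (alphaGen α)) t ≤ ENNReal.ofReal (t ^ 2 / 8)) ∧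
      ∀ μ ν : Measure Ω, IsProbabilityMeasure μ → IsProbabilityMeasure ν →
        ENNReal.ofReal (tvDist μ ν ^ 2 / 2) ≤ phiDiv (alphaGen α) μ ν) ∧
    -- Pinsker's inequality
    (∀ μ ν : Measure Ω, IsProbabilityMeasure μ → IsProbabilityMeasure ν →
      ENNReal.ofReal (tvDist μ ν ^ 2 / 2) ≤ InformationTheory.klDiv μ ν) ∧
    -- Hoeffding's lemma
    (∀ ν : Measure Ω, IsProbabilityMeasure ν → ∀ (g : Ω → ℝ) (m M : ℝ), AEMeasurable g ν →
      (∀ᵐ ω ∂ν, m ≤ g ω ∧ g ω ≤ M) → ∀ t : ℝ,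
        Real.log (∫ ω, Real.exp (t * (g ω - ∫ ω', g ω' ∂ν)) ∂ν) ≤ (M - m) ^ 2 * t ^ 2 / 8) := by
  have three : ∀ φ : ℝ → ℝ≥0∞, IsGenerator φ → ThirdOrderCondition φ →
      (∀ t : ℝ, 0 ≤ t →
        heightForWidth (psiStar φ) t ≤ ENNReal.ofReal (t ^ 2 / (8 * secondDeriv φ 1))) ∧
      ∀ μ ν : Measure Ω, IsProbabilityMeasure μ → IsProbabilityMeasure ν →
        ENNReal.ofReal (secondDeriv φ 1 / 2 * tvDist μ ν ^ 2) ≤ phiDiv φ μ ν := by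
    intro φ hφ h
    obtain ⟨b, hb⟩ := h.exists_rationalLowerBound hφ
    exact hb.height_and_divergence_bounds h.secondDeriv_one_pos
  have alpha : ∀ α : ℝ, -1 ≤ α → α ≤ 2 →
      (∀ t : ℝ, 0 ≤ t →
        heightForWidth (psiStar (alphaGen α)) t ≤ ENNReal.ofReal (t ^ 2 / 8)) ∧
      ∀ μ ν : Measure Ω, IsProbabilityMeasure μ → IsProbabilityMeasure ν →
        ENNReal.ofReal (tvDist μ ν ^ 2 / 2) ≤ phiDiv (alphaGen α) μ ν := by
    intro α h1 h2
    have := three _ (isGenerator_alphaGen α) (thirdOrderCondition_alphaGen h1 h2)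
    simpa only [secondDeriv_alphaGen_one, mul_one, one_div_mul_eq_div] using this
  refine ⟨three, fun φ hφ h => ?_, fun φ hφ h => hφ.psiStarBlowsUp_of_slopeAtTop_eq_top h,
    fun φ hφ h1 h2 ⟨A, hA, hA0, hA1⟩ K hK => ?_, fun α h1 h2 => ?_, fun μ ν hμ hν => ?_,
    fun ν hν g m M hg hmM t => log_integral_exp_le_of_ae_mem_Icc hg hmM t⟩
  · obtain ⟨b, hb⟩ := h.exists_rationalLowerBound hφ
    exact hb.height_and_divergence_bounds (h.secondDeriv_pos 1 hφ.one_mem)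
  · refine hφ.le_half_secondDeriv h1 h2 fun ε hε0 hε1 => ?_
    obtain ⟨μ, ν, hμ, hν, hD, hT⟩ := exists_phiDiv_eq_and_tvDist_eq hA hA0 hA1 φ hε0 hε1
    rw [← hD, ← hT]
    exact hK μ ν hμ hν
  · exact ⟨isGenerator_alphaGen α, thirdOrderCondition_alphaGen h1 h2,
      fun h => concaveCondition_alphaGen h h2, alpha α h1 h2⟩
  · exact ((alpha 1 (by norm_num) (by norm_num)).2 μ ν hμ hν).trans
      (phiDiv_alphaGen_one_le_klDiv μ ν)
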